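/- Let $\mathfrak g$ be a finite-dimensional semisimple Lie algebra over a field $K$ of characteristic zero, with Killing form $\langle\,,\rangle$, and let $\mathfrak g=\mathfrak g_0\oplus\mathfrak g_1$ be a symmetric decomposition: $\mathfrak g_0$ is a subalgebra and $\mathfrak g_1$ a subspace with $[\mathfrak g_0,\mathfrak g_1]\subset\mathfrak g_1$ and $[\mathfrak g_1,\mathfrak g_1]\subset\mathfrak g_0$. Let $\mathfrak a$ be a maximal Abelian subspace of $\mathfrak g_1$ on which the Killing form is nondegenerate (equivalently, $\mathfrak g_1=\mathfrak a\oplus\mathfrak m$ for the space $\mathfrak m$ below), and let $k=\dim\mathfrak a$. Put $$\mathfrak m=\mathfrak a^\perp\cap\mathfrak g_1,\qquad (\mathfrak g_0)_{\mathfrak a}=\{X\in\mathfrak g_0: [X,\mathfrak a]=0\},\qquad \mathfrak b=\mathfrak g_0\cap(\mathfrak g_0)_{\mathfrak a}^{\perp},$$ where $\perp$ refers to the Killing form. For subspaces $\mathfrak a,\mathfrak b$ of $\mathfrak g$ with $\mathfrak a\cap\mathfrak b=0$ and a subspace $\mathcal A\subset\mathrm{Hom}(\mathfrak a,\mathfrak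 b)$, let $\rho:\mathrm{Hom}(\mathfrak a,\mathcal A)\to\mathfrak b\otimes\Lambda^2(\mathfrak a^*)$ be $\rho(F)(A_1,A_2)=\frac12\big(F(A_1)(A_2)-F(A_2)(A_1)\big)$ and let $\mathcal A^{(1)}=\ker\rho$. For a complete flag $\ell:0=\mathfrak a_0\subset\mathfrak a_1\subset\cdots\subset\mathfrak a_k=\mathfrak a$ let $\mathcal A_j(\ell)=\{Q\in\mathcal A: Q|_{\mathfrak a_j}=0\}$; the flag is generic if for every $j$ the number $\dim\mathcal A_j(\ell)$ is minimal among all complete flags. The characters $s'_1,\dots,s'_k$ of $\mathcal A$ are defined by $s'_1+\cdots+s'_j=\dim\mathcal A-\dim\mathcal A_j(\ell)$, $j=1,\dots,k$, with $\ell$ generic, and $\mathcal A$ is involutive if $\dim\mathcal A^{(1)}=s'_1+2s'_2+\cdots+ks'_k$. For $Q\in\mathcal A$ let $R_Q(A_1,A_2)$ be the class of $[A_1+Q(A_1),A_2+Q(A_2)]$ in $\mathfrak g/(\mathfrak a\oplus\mathfrak b)$; if $R_Q=0$, let $$\tau_Q(A_1,A_2)=[A_1+Q(A_1),A_2+Q(A_2)]_{\mathfrak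 b}-Q\big([A_1+Q(A_1),A_2+Q(A_2)]_{\mathfrak a}\big),$$ the subscripts denoting components in $\mathfrak a\oplus\mathfrak b$. One calls $\mathcal A$ a tableau over $\mathfrak g$ if $R_Q=0$ and $\tau_Q\in\mathrm{Im}\,\rho$ for every $Q\in\mathcal A$, and $\mathcal A$ is involutive. Then $X\mapsto-\mathrm{ad}_X|_{\mathfrak a}$ is an injective linear map $\mathfrak m\to\mathrm{Hom}(\mathfrak a,\mathfrak b)$, and its image, that is $\mathfrak m$ regarded as a subspace of $\mathrm{Hom}(\mathfrak a,\mathfrak b)$, is a tableau over $\mathfrak g$ (the Cartan tableau), with characters $s'_1=\dim\mathfrak m$ and $s'_j=0$ for $2\le j\le k$. -/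

import Mathlib

open Module

noncomputable section

namespace LieTableau

section Tableau

variable {K V W : Type*} [Field K] [AddCommGroup V] [Module K V] [AddCommGroup W] [Module K W]

/-- The map `ρ : Hom(V, A) → W ⊗ Λ²(V*)`,
`ρ(F)(v₁, v₂) = ½ (F(v₁)(v₂) - F(v₂)(v₁))`, for a subspace `A` of `Hom(V, W)`.
Elements of `W ⊗ Λ²(V*)` are regarded as (alternating) bilinear maps `V × V → W`. -/
def rho (A : Submodule K (V →ₗ[K] W)) : (V →ₗ[K] A) →ₗ[K] (V →ₗ[K] V →ₗ[K] W) where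
  toFun F := (2 : K)⁻¹ • (A.subtype ∘ₗ F - (A.subtype ∘ₗ F).flip)
  map_add' F G := by
    ext v w
    simp only [LinearMap.smul_apply, LinearMap.sub_apply, LinearMap.flip_apply,
      LinearMap.add_apply, LinearMap.comp_apply, map_add, ← smul_add]
    congr 1
    abel
  map_smul' c F := by
    ext v w
    simp only [LinearMap.smul_apply, LinearMap.sub_apply, LinearMap.flip_apply,
      LinearMap.comp_apply, map_smul, RingHom.id_apply, ← smul_sub]
    rw [smul_comm]

/-- The first prolongation `A⁽¹⁾ ⊆ Hom(V, A)`: the kernel of `ρ`. -/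
def prolongation (A : Submodule K (V →ₗ[K] W)) : Submodule K (V →ₗ[K] A) :=
  LinearMap.ker (rho A)

variable (K V) in
/-- A complete flag `0 = V₀ ⊂ V₁ ⊂ ⋯ ⊂ V_k = V`, with `dim V_j = j` and `k = dim V`. -/
structure CompleteFlag where
  /-- The members of the flag. -/
  space : Fin (finrank K V + 1) → Submodule K V
  mono : Monotone space
  finrank_space : ∀ j, finrank K (space j) = j

/-- `A_j(ℓ) = {Q ∈ A : Q vanishes on V_j}`. -/
def annihilated (A : Submodule K (V →ₗ[K] W)) (l : CompleteFlag K V)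
    (j : Fin (finrank K V + 1)) : Submodule K (V →ₗ[K] W) where
  carrier := {Q | Q ∈ A ∧ ∀ v ∈ l.space j, Q v = 0}
  add_mem' := by
    rintro P Q ⟨hP, hP'⟩ ⟨hQ, hQ'⟩
    exact ⟨A.add_mem hP hQ, fun v hv => by simp [hP' v hv, hQ' v hv]⟩
  zero_mem' := ⟨A.zero_mem, fun _ _ => rfl⟩
  smul_mem' := by
    rintro c Q ⟨hQ, hQ'⟩
    exact ⟨A.smul_mem c hQ, fun v hv => by simp [hQ' v hv]⟩

/-- A flag is generic with respect to `A` if every `dim A_j(ℓ)` is the minimum over all flags. -/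
def IsGeneric (A : Submodule K (V →ₗ[K] W)) (l : CompleteFlag K V) : Prop :=
  ∀ (j : Fin (finrank K V + 1)) (l' : CompleteFlag K V),
    finrank K (annihilated A l j) ≤ finrank K (annihilated A l' j)

/-- `s` is the sequence of characters of `A`; the character `s'_j`, `1 ≤ j ≤ k = dim V`, is
`s (j - 1)`, the indices of `s` starting from `0`. They are determined by
`s'_1 + ⋯ + s'_j = dim A - dim A_j(ℓ)` for a generic flag `ℓ`. (All generic flags have
the same dimensions `dim A_j(ℓ)`, so that the choice of `ℓ` does not matter.) -/
def HasCharacters (A : Submodule K (V →ₗ[K] W)) (s : Fin (finrank K V) → ℕ) : Prop :=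
  ∃ l : CompleteFlag K V, IsGeneric A l ∧
    ∀ j : Fin (finrank K V + 1),
      (∑ i : Fin (finrank K V) with i.val < j.val, s i) + finrank K (annihilated A l j) =
        finrank K A

/-- `A` is involutive: `dim A⁽¹⁾ = s'_1 + 2 s'_2 + ⋯ + k s'_k`. -/
def IsInvolutive (A : Submodule K (V →ₗ[K] W)) : Prop :=
  ∃ s : Fin (finrank K V) → ℕ, HasCharacters A s ∧
    finrank K (prolongation A) = ∑ i : Fin (finrank K V), (i.val + 1) * s i

end Tableau

section LieAlgebra

variable {K g : Type*} [Field K] [LieRing g] [LieAlgebra K g]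

/-- The bilinear map `(A₁, A₂) ↦ [A₁ + Q(A₁), A₂ + Q(A₂)]`. -/
def graphBracket {a b : Submodule K g} (Q : a →ₗ[K] b) : a →ₗ[K] a →ₗ[K] g :=
  (LieModule.toEnd K g g : g →ₗ[K] End K g).compl₁₂
    (a.subtype + b.subtype ∘ₗ Q) (a.subtype + b.subtype ∘ₗ Q)

/-- The form `R_Q` on `a` with values in `g / (a ⊕ b)`. -/
def R {a b : Submodule K g} (Q : a →ₗ[K] b) : a →ₗ[K] a →ₗ[K] g ⧸ (a ⊔ b) :=
  (graphBracket Q).compr₂ (a ⊔ b).mkQ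

/-- If `a ∩ b = 0`, the decomposition of the elements of `a ⊕ b` into
their `a`- and `b`-components. -/
def components {a b : Submodule K g} (hab : Disjoint a b) : ↥(a ⊔ b) ≃ₗ[K] a × b :=
  ((LinearEquiv.ofInjective (a.subtype.coprod b.subtype) (by
    rw [← LinearMap.ker_eq_bot, LinearMap.ker_coprod_of_disjoint_range]
    · simp
    · simpa using hab)).trans (LinearEquiv.ofEq _ _ (by
      rw [LinearMap.range_coprod, Submodule.range_subtype, Submodule.range_subtype]))).symm

theorem graphBracket_mem {a b : Submodule K g} {Q : a →ₗ[K] b} (hR : R Q = 0) (x y : a) :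
    graphBracket Q x y ∈ a ⊔ b := by
  have h := LinearMap.congr_fun₂ hR x y
  simpa [R] using h

/-- If `R_Q = 0`, the `b`-valued form
`τ_Q(A₁, A₂) = [A₁ + Q(A₁), A₂ + Q(A₂)]_b - Q([A₁ + Q(A₁), A₂ + Q(A₂)]_a)`. -/
def tau {a b : Submodule K g} (hab : Disjoint a b) (Q : a →ₗ[K] b) (hR : R Q = 0) :
    a →ₗ[K] a →ₗ[K] b :=
  let T : ↥(a ⊔ b) →ₗ[K] b :=
    (LinearMap.snd K a b - Q ∘ₗ LinearMap.fst K a b) ∘ₗ (components hab).toLinearMap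
  LinearMap.mk₂ K (fun x y => T ⟨graphBracket Q x y, graphBracket_mem hR x y⟩)
    (fun x x' y => by rw [← map_add]; congr 1; ext; simp)
    (fun c x y => by rw [← map_smul]; congr 1; ext; simp)
    (fun x y y' => by rw [← map_add]; congr 1; ext; simp)
    (fun c x y => by rw [← map_smul]; congr 1; ext; simp)

/-- `A ⊆ Hom(a, b)` is a tableau over the Lie algebra `g`. -/
structure IsTableauOver (a b : Submodule K g) (A : Submodule K (a →ₗ[K] b)) : Prop where
  disjoint : Disjoint a b
  R_eq_zero : ∀ Q ∈ A, R Q = 0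
  tau_mem : ∀ (Q : a →ₗ[K] b) (hQ : Q ∈ A),
    tau disjoint Q (R_eq_zero Q hQ) ∈ LinearMap.range (rho A)
  involutive : IsInvolutive A

/-- A symmetric decomposition `g = g₀ ⊕ g₁`; as `g₀` is a subalgebra, `[g₀, g₀] ⊆ g₀`. -/
structure IsSymmetricDecomposition (g₀ : LieSubalgebra K g) (g₁ : Submodule K g) : Prop where
  isCompl : IsCompl g₀.toSubmodule g₁
  lie_zero_one : ∀ x ∈ g₀, ∀ y ∈ g₁, ⁅x, y⁆ ∈ g₁
  lie_one_one : ∀ x ∈ g₁, ∀ y ∈ g₁, ⁅x, y⁆ ∈ g₀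

/-- `a` is a maximal Abelian subspace of `g₁`. -/
def IsMaximalAbelian (g₁ a : Submodule K g) : Prop :=
  Maximal (fun s : Submodule K g => s ≤ g₁ ∧ ∀ x ∈ s, ∀ y ∈ s, ⁅x, y⁆ = 0) a

/-- `m = a^⊥ ∩ g₁`, with respect to the Killing form. -/
def mSpace (g₁ a : Submodule K g) : Submodule K g :=
  (killingForm K g).orthogonal a ⊓ g₁

/-- `(g₀)_a = {X ∈ g₀ : [X, a] = 0}`. -/
def centralizerIn (g₀ : LieSubalgebra K g) (a : Submodule K g) : Submodule K g where
  carrier := {x | x ∈ g₀ ∧ ∀ y ∈ a, ⁅x, y⁆ = 0}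
  add_mem' := by
    rintro x x' ⟨hx, hx'⟩ ⟨h, h'⟩
    exact ⟨g₀.add_mem hx h, fun y hy => by simp [hx' y hy, h' y hy]⟩
  zero_mem' := ⟨g₀.zero_mem, fun y _ => zero_lie y⟩
  smul_mem' := by
    rintro c x ⟨hx, hx'⟩
    exact ⟨g₀.smul_mem c hx, fun y hy => by simp [hx' y hy]⟩

/-- `b = g₀ ∩ (g₀)_a^⊥`, with respect to the Killing form. -/
def bSpace (g₀ : LieSubalgebra K g) (a : Submodule K g) : Submodule K g :=
  g₀.toSubmodule ⊓ (killingForm K g).orthogonal (centralizerIn g₀ a)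

theorem neg_lie_mem_bSpace {g₀ : LieSubalgebra K g} {g₁ a : Submodule K g}
    (h : IsSymmetricDecomposition g₀ g₁) (ha : a ≤ g₁) {x y : g}
    (hx : x ∈ mSpace g₁ a) (hy : y ∈ a) : -⁅x, y⁆ ∈ bSpace g₀ a := by
  refine ⟨g₀.neg_mem (h.lie_one_one x hx.2 y (ha hy)), fun z hz => ?_⟩
  rw [lie_skew, killingForm, ← LieModule.traceForm_apply_lie_apply, hz.2 y hy]
  simp

/-- The map `m → Hom(a, b)`, `X ↦ -ad_X`. -/
def cartanMap {g₀ : LieSubalgebra K g} {g₁ a : Submodule K g}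
    (h : IsSymmetricDecomposition g₀ g₁) (ha : a ≤ g₁) :
    mSpace g₁ a →ₗ[K] (a →ₗ[K] bSpace g₀ a) :=
  LinearMap.mk₂ K (fun x y => ⟨-⁅(x : g), (y : g)⁆, neg_lie_mem_bSpace h ha x.2 y.2⟩)
    (fun x x' y => by ext; simp [add_comm])
    (fun c x y => by ext; simp [← smul_neg])
    (fun x y y' => by ext; simp [add_comm])
    (fun c x y => by ext; simp [← smul_neg])

/-- The Cartan tableau: `m` regarded as a subspace of `Hom(a, b)` through `X ↦ -ad_X`. -/
def cartanTableau {g₀ : LieSubalgebra K g} {g₁ a : Submodule K g}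
    (h : IsSymmetricDecomposition g₀ g₁) (ha : a ≤ g₁) : Submodule K (a →ₗ[K] bSpace g₀ a) :=
  LinearMap.range (cartanMap h ha)

end LieAlgebra

end LieTableau

end

/-! Everything rests on a regular element $x\in\mathfrak a$, one whose centralizer in $\mathfrak g$
is that of all of $\mathfrak a$. By the Jordan decomposition, maximality of $\mathfrak a$ and
nondegeneracy of the form on it, each $\mathrm{ad}_y$ with $y\in\mathfrak a$ is semisimple
(`IsMaximalAbelian.isSemisimple_ad`); in a commuting linear family of semisimple maps some member
has the smallest kernel (`exists_forall_ker_le`).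

Evaluation at $x$, $X\mapsto-[X,x]$, is then a bijection $\mathfrak m\to\mathfrak b$. An
$X\in\mathfrak m$ commuting with $x$ commutes with $\mathfrak a$, so lies in $\mathfrak
a\cap\mathfrak a^\perp=0$; surjectivity comes from $\mathfrak
g=\ker\mathrm{ad}_x\oplus\mathrm{im}\,\mathrm{ad}_x$. A flag starting with a line containing $x$
therefore gives $\mathcal A_j=0$ for $j\ge1$, whence the characters. An element $F$ of the
prolongation is determined by $F(x)$, which can be prescribed freely, so $\dim\mathcal
A^{(1)}=\dim\mathcal A=s'_1$.

For $Q=-\mathrm{ad}_X$ the bracket on the graph reduces to $[[X,y],[X,z]]$. It lies in $\mathfrak b$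
by invariance of the Killing form, so $R_Q=0$, and the Jacobi identity writes it as $\rho(F)$ with
$F(y)=-\mathrm{ad}$ of the $\mathfrak m$-part of $[X,[X,y]]$. -/

namespace LieTableau

/-! ### Semisimple and nilpotent endomorphisms; flags through a vector. -/

section LinearAlgebra

variable {K V : Type*} [Field K] [AddCommGroup V] [Module K V]

/-- Only powers need to be respected, because precomposition reverses products and is not an algebra
homomorphism. -/
theorem aeval_map_of_map_pow {A B : Type*} [Ring A] [Algebra K A] [Ring B] [Algebra K B]
    (r : A →ₗ[K] B) {x : A} (hr : ∀ n : ℕ, r (x ^ n) = r x ^ n) (p : Polynomial K) :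
    Polynomial.aeval (r x) p = r (Polynomial.aeval x p) := by
  simp only [Polynomial.aeval_eq_sum_range, map_sum, map_smul, hr]

theorem isSemisimple_map_of_map_pow [FiniteDimensional K V] {E : Type*} [AddCommGroup E]
    [Module K E] (r : End K V →ₗ[K] End K E) {S : End K V} (hr : ∀ n : ℕ, r (S ^ n) = r S ^ n)
    (hS : S.IsSemisimple) : (r S).IsSemisimple := by
  refine End.isSemisimple_of_squarefree_aeval_eq_zero hS.minpoly_squarefree ?_
  rw [aeval_map_of_map_pow r hr, minpoly.aeval, map_zero]

theorem isNilpotent_map_of_map_pow {E : Type*} [AddCommGroup E]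
    [Module K E] (r : End K V →ₗ[K] End K E) {N : End K V} (hr : ∀ n : ℕ, r (N ^ n) = r N ^ n)
    (hN : IsNilpotent N) : IsNilpotent (r N) := by
  obtain ⟨n, hn⟩ := hN
  exact ⟨n, by rw [← hr, hn, map_zero]⟩

theorem apply_eq_zero_of_pow_apply_eq_zero {S : End K V} (hS : S.IsSemisimple) {n : ℕ} {v : V}
    (hv : (S ^ n) v = 0) : S v = 0 := by
  have h : v ∈ S.maxGenEigenspace 0 := by
    rw [End.mem_maxGenEigenspace]
    exact ⟨n, by simpa using hv⟩
  rw [hS.isFinitelySemisimple.maxGenEigenspace_eq_eigenspace] at h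
  simpa using h

/-- On $\ker(N+S)$ the map $S$ acts as $-N$, hence nilpotently; a semisimple map vanishes on vectors
killed by one of its powers. -/
theorem apply_eq_zero_of_add_apply_eq_zero {N S : End K V} (hN : IsNilpotent N)
    (hS : S.IsSemisimple) (hc : Commute N S) {v : V} (hv : (N + S) v = 0) : S v = 0 := by
  obtain ⟨n, hn⟩ := hN
  have key : ∀ k : ℕ, (S ^ k) v = ((-N) ^ k) v := by
    intro k
    induction k with
    | zero => simp
    | succ k ih =>
      have h1 : S v = (-N) v := by
        rw [LinearMap.neg_apply, eq_neg_iff_add_eq_zero, add_comm]; exact hv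
      have h2 : Commute (S ^ k) (-N) := (hc.symm.neg_right).pow_left k
      rw [pow_succ, Module.End.mul_apply, h1, ← Module.End.mul_apply, h2.eq, Module.End.mul_apply, ih,
        ← Module.End.mul_apply, ← pow_succ']
  refine apply_eq_zero_of_pow_apply_eq_zero hS (n := n) ?_
  rw [key, neg_pow, hn]; simp

theorem isCompl_ker_range [FiniteDimensional K V] {S : End K V} (hS : S.IsSemisimple) :
    IsCompl (LinearMap.ker S) (LinearMap.range S) := by
  have hD : Disjoint (LinearMap.ker S) (LinearMap.range S) := by
    rw [Submodule.disjoint_def]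
    rintro _ hv ⟨v, rfl⟩
    exact apply_eq_zero_of_pow_apply_eq_zero hS (n := 2) (by rw [pow_two]; exact hv)
  exact ⟨hD, codisjoint_iff.2 (Submodule.eq_top_of_disjoint _ _ (by
    rw [add_comm, LinearMap.finrank_range_add_finrank_ker]) hD)⟩

variable (K V) in
/-- Postcomposition of `V`-valued bilinear maps with endomorphisms of `V`. -/
def postcompose : End K V →ₗ[K] End K (V →ₗ[K] V →ₗ[K] V) :=
  LinearMap.mk₂ K (fun X φ => φ.compr₂ X)
    (fun _ _ _ => by ext; simp) (fun _ _ _ => by ext; simp)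
    (fun _ _ _ => by ext; simp) (fun _ _ _ => by ext; simp)

variable (K V) in
/-- Precomposition of the first argument of bilinear maps with endomorphisms of `V`. -/
def precomposeLeft : End K V →ₗ[K] End K (V →ₗ[K] V →ₗ[K] V) :=
  LinearMap.mk₂ K (fun X φ => φ.comp X)
    (fun _ _ _ => by ext; simp) (fun _ _ _ => by ext; simp)
    (fun _ _ _ => by ext; simp) (fun _ _ _ => by ext; simp)

variable (K V) in
/-- Precomposition of the second argument of bilinear maps with endomorphisms of `V`. -/
def precomposeRight : End K V →ₗ[K] End K (V →ₗ[K] V →ₗ[K] V) :=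
  LinearMap.mk₂ K (fun X φ => φ.compl₂ X)
    (fun _ _ _ => by ext; simp) (fun _ _ _ => by ext; simp)
    (fun _ _ _ => by ext; simp) (fun _ _ _ => by ext; simp)

@[simp] theorem postcompose_apply (X : End K V) (φ : V →ₗ[K] V →ₗ[K] V) (v w : V) :
    postcompose K V X φ v w = X (φ v w) := rfl

@[simp] theorem precomposeLeft_apply (X : End K V) (φ : V →ₗ[K] V →ₗ[K] V) (v w : V) :
    precomposeLeft K V X φ v w = φ (X v) w := rfl

@[simp] theorem precomposeRight_apply (X : End K V) (φ : V →ₗ[K] V →ₗ[K] V) (v w : V) :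
    precomposeRight K V X φ v w = φ v (X w) := rfl

theorem postcompose_pow (X : End K V) (n : ℕ) :
    postcompose K V (X ^ n) = postcompose K V X ^ n := by
  induction n with
  | zero => ext; simp
  | succ n ih => rw [pow_succ', pow_succ', ← ih]; ext; simp

theorem precomposeLeft_pow (X : End K V) (n : ℕ) :
    precomposeLeft K V (X ^ n) = precomposeLeft K V X ^ n := by
  induction n with
  | zero => ext; simp
  | succ n ih => rw [pow_succ, pow_succ', ← ih]; ext; simp

theorem precomposeRight_pow (X : End K V) (n : ℕ) :
    precomposeRight K V (X ^ n) = precomposeRight K V X ^ n := by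
  induction n with
  | zero => ext; simp
  | succ n ih => rw [pow_succ, pow_succ', ← ih]; ext; simp

theorem commute_postcompose_precomposeLeft (X Y : End K V) :
    Commute (postcompose K V X) (precomposeLeft K V Y) := by
  ext; simp

theorem commute_postcompose_precomposeRight (X Y : End K V) :
    Commute (postcompose K V X) (precomposeRight K V Y) := by
  ext; simp

theorem commute_precomposeLeft_precomposeRight (X Y : End K V) :
    Commute (precomposeLeft K V X) (precomposeRight K V Y) := by
  ext; simp

theorem isNilpotent_sub_sub {E : Type*} [AddCommGroup E] [Module K E] {p q r : End K E}
    (hpq : Commute p q) (hpr : Commute p r) (hqr : Commute q r)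
    (hp : IsNilpotent p) (hq : IsNilpotent q) (hr : IsNilpotent r) : IsNilpotent (p - q - r) :=
  (hpr.sub_left hqr).isNilpotent_sub (hpq.isNilpotent_sub hp hq) hr

theorem isSemisimple_sub_sub {E : Type*} [AddCommGroup E] [Module K E] [PerfectField K]
    [FiniteDimensional K E] {p q r : End K E}
    (hpq : Commute p q) (hpr : Commute p r) (hqr : Commute q r)
    (hp : p.IsSemisimple) (hq : q.IsSemisimple) (hr : r.IsSemisimple) :
    (p - q - r).IsSemisimple :=
  (hp.sub_of_commute hpq hq).sub_of_commute (hpr.sub_left hqr) hr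

variable (K V) in
/-- The natural action of endomorphisms of `V` on bilinear maps `V × V → V`. A bracket is
annihilated by `X` exactly when `X` is a derivation of it. -/
def bilinAction : End K V →ₗ[K] End K (V →ₗ[K] V →ₗ[K] V) where
  toFun X := postcompose K V X - precomposeLeft K V X - precomposeRight K V X
  map_add' X Y := by simp only [map_add]; abel
  map_smul' c X := by ext φ v w; simp [smul_sub]

@[simp] theorem bilinAction_apply (X : End K V) (φ : V →ₗ[K] V →ₗ[K] V) (v w : V) :
    bilinAction K V X φ v w = X (φ v w) - φ (X v) w - φ v (X w) := rfl

theorem isNilpotent_bilinAction {N : End K V} (hN : IsNilpotent N) :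
    IsNilpotent (bilinAction K V N) :=
  isNilpotent_sub_sub (commute_postcompose_precomposeLeft N N)
    (commute_postcompose_precomposeRight N N) (commute_precomposeLeft_precomposeRight N N)
    (isNilpotent_map_of_map_pow _ (postcompose_pow N) hN)
    (isNilpotent_map_of_map_pow _ (precomposeLeft_pow N) hN)
    (isNilpotent_map_of_map_pow _ (precomposeRight_pow N) hN)

theorem isSemisimple_bilinAction [PerfectField K] [FiniteDimensional K V] {S : End K V}
    (hS : S.IsSemisimple) : (bilinAction K V S).IsSemisimple :=
  isSemisimple_sub_sub (commute_postcompose_precomposeLeft S S)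
    (commute_postcompose_precomposeRight S S) (commute_precomposeLeft_precomposeRight S S)
    (isSemisimple_map_of_map_pow _ (postcompose_pow S) hS)
    (isSemisimple_map_of_map_pow _ (precomposeLeft_pow S) hS)
    (isSemisimple_map_of_map_pow _ (precomposeRight_pow S) hS)

theorem commute_bilinAction {X Y : End K V} (h : Commute X Y) :
    Commute (bilinAction K V X) (bilinAction K V Y) := by
  have h' : ∀ v, X (Y v) = Y (X v) := fun v => LinearMap.congr_fun h.eq v
  ext φ v w
  simp only [Module.End.mul_apply, bilinAction_apply, map_sub, h']
  abel

/-- The semisimple part of a derivation of a bilinear product is a derivation. -/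
theorem semisimple_part_derivation [PerfectField K] [FiniteDimensional K V]
    {N S : End K V} (hN : IsNilpotent N) (hS : S.IsSemisimple) (hc : Commute N S)
    (φ : V →ₗ[K] V →ₗ[K] V)
    (hD : ∀ v w, (N + S) (φ v w) = φ ((N + S) v) w + φ v ((N + S) w)) (v w : V) :
    S (φ v w) = φ (S v) w + φ v (S w) := by
  have h : (bilinAction K V N + bilinAction K V S) φ = 0 := by
    rw [← map_add]
    ext v w
    rw [bilinAction_apply, hD]
    simp
  have := LinearMap.congr_fun₂ (apply_eq_zero_of_add_apply_eq_zero (isNilpotent_bilinAction hN)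
    (isSemisimple_bilinAction hS) (commute_bilinAction hc) h) v w
  rw [bilinAction_apply, LinearMap.zero_apply, LinearMap.zero_apply, sub_sub, sub_eq_zero] at this
  exact this

/-- In a linear family of commuting semisimple endomorphisms over an infinite field, some member
has the smallest kernel. -/
theorem exists_forall_ker_le [Infinite K] [FiniteDimensional K V] {U : Type*} [AddCommGroup U]
    [Module K U] (f : U →ₗ[K] End K V) (hc : ∀ x y, Commute (f x) (f y))
    (hs : ∀ x, (f x).IsSemisimple) :
    ∃ x, ∀ y, LinearMap.ker (f x) ≤ LinearMap.ker (f y) := by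
  obtain ⟨x, hx⟩ : ∃ x, ∀ y, finrank K (LinearMap.ker (f x)) ≤ finrank K (LinearMap.ker (f y)) :=
    ⟨Function.argmin (fun x => finrank K (LinearMap.ker (f x))), fun y =>
      Function.argmin_le (fun x => finrank K (LinearMap.ker (f x))) y⟩
  refine ⟨x, fun y => ?_⟩
  have hcomm : ∀ v, f x (f y v) = f y (f x v) := fun v => LinearMap.congr_fun (hc x y).eq v
  have hI := isCompl_ker_range (hs x)
  have hD := hI.disjoint
  let F : End K (LinearMap.range (f x)) := (f x).restrict fun v _ => LinearMap.mem_range_self _ v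
  let G : End K (LinearMap.range (f x)) := (f y).restrict (by
    rintro _ ⟨v, rfl⟩
    exact ⟨f y v, hcomm v⟩)
  have hF : Function.Injective F := by
    rw [← LinearMap.ker_eq_bot, LinearMap.ker_eq_bot']
    rintro ⟨v, hv⟩ h
    have h' : f x v = 0 := congrArg Subtype.val h
    exact Subtype.ext ((Submodule.disjoint_def.1 hD) v h' hv)
  let e := LinearEquiv.ofInjectiveEndo F hF
  -- On the range of `f x`, a vector killed by `μ • f x - f y` is an eigenvector of `F⁻¹ G` for `μ`.
  -- The eigenvalues are finitely many and `K` is infinite, so `μ` can avoid them.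
  obtain ⟨μ, hμ⟩ := (End.finite_hasEigenvalue (e.symm.toLinearMap ∘ₗ G)).exists_notMem
  have hker : LinearMap.ker (f (μ • x - y)) ≤ LinearMap.ker (f x) ⊓ LinearMap.ker (f y) := by
    intro v hv
    obtain ⟨v₀, hv₀, v₁, hv₁, rfl⟩ := Submodule.mem_sup.1
      (hI.sup_eq_top ▸ Submodule.mem_top : v ∈ LinearMap.ker (f x) ⊔ LinearMap.range (f x))
    rw [LinearMap.mem_ker] at hv₀
    have hsum : f y v₀ = μ • f x v₁ - f y v₁ := by
      have : f (μ • x - y) (v₀ + v₁) = 0 := hv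
      simp only [map_sub, map_smul, LinearMap.sub_apply, LinearMap.smul_apply, map_add, hv₀,
        smul_zero, zero_sub] at this
      exact neg_add_eq_zero.1 this
    have h0 : f y v₀ = 0 := by
      refine Submodule.disjoint_def.1 hD _ (by rw [LinearMap.mem_ker, hcomm, hv₀, map_zero]) ?_
      rw [hsum]
      refine sub_mem (Submodule.smul_mem _ _ (LinearMap.mem_range_self _ _)) ?_
      exact (G ⟨v₁, hv₁⟩).2
    have h1 : v₁ = 0 := by
      by_contra hne
      refine hμ (End.hasEigenvalue_of_hasEigenvector (x := ⟨v₁, hv₁⟩) ⟨?_, ?_⟩)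
      · rw [End.mem_eigenspace_iff, LinearMap.comp_apply, LinearEquiv.coe_coe,
          LinearEquiv.symm_apply_eq]
        apply Subtype.ext
        have : f y v₁ = f x (μ • v₁) := by
          rw [map_smul]; exact (sub_eq_zero.1 (hsum.symm.trans h0)).symm
        exact this
      · simpa using hne
    subst h1
    exact ⟨by simpa using hv₀, by simpa using h0⟩
  -- Minimality of the kernel of `f x` forces the intersection to be all of it.
  have := (hx (μ • x - y)).trans (Submodule.finrank_mono hker)
  rw [← Submodule.eq_of_le_of_finrank_le inf_le_left this]
  exact inf_le_right

theorem finrank_flag {n : ℕ} (b : Basis (Fin n) K V) (k : Fin (n + 1)) :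
    finrank K (b.flag k) = k := by
  have hli : LinearIndependent K (fun i : {i : Fin n // i.castSucc < k} => b i) :=
    b.linearIndependent.comp _ Subtype.val_injective
  have h : b.flag k = Submodule.span K (Set.range fun i : {i : Fin n // i.castSucc < k} => b i) := by
    rw [Basis.flag]; congr 1; ext; simp
  rw [h, finrank_span_eq_card hli, Fintype.card_subtype]
  have := k.is_le
  simp only [Fin.lt_def, Fin.val_castSucc]
  rw [Fin.card_filter_val_lt]
  omega

/-- Every vector lies in the line of some complete flag. -/
theorem exists_completeFlag_mem [FiniteDimensional K V] (v : V) :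
    ∃ l : CompleteFlag K V, ∀ j, j ≠ 0 → v ∈ l.space j := by
  suffices ∃ b : Basis (Fin (finrank K V)) K V, ∀ j, j ≠ 0 → v ∈ b.flag j by
    obtain ⟨b, hb⟩ := this
    exact ⟨⟨b.flag, b.flag_mono, finrank_flag b⟩, hb⟩
  by_cases hv : v = 0
  · exact ⟨finBasis K V, fun j _ => hv ▸ zero_mem _⟩
  let b := Basis.extend (LinearIndepOn.singleton (R := K) (v := id) (i := v) hv)
  have hb : v ∈ Set.range b := by
    rw [Basis.range_extend]
    exact Basis.subset_extend _ rfl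
  obtain ⟨i, hi⟩ := hb
  have : Fintype _ := FiniteDimensional.fintypeBasisIndex b
  let e := Fintype.equivFinOfCardEq (finrank_eq_card_basis b).symm
  have : NeZero (finrank K V) := ⟨fun h => (h ▸ e i : Fin 0).elim0⟩
  obtain ⟨c, rfl⟩ : ∃ c : Basis (Fin (finrank K V)) K V, c 0 = v :=
    ⟨b.reindex (e.trans (Equiv.swap (e i) 0)), by rw [Basis.reindex_apply]; simp [hi]⟩
  refine ⟨c, fun j hj => c.self_mem_flag ?_⟩
  rw [Fin.lt_def]
  exact Nat.pos_of_ne_zero fun h => hj (Fin.ext h)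

end LinearAlgebra

/-! ### Symmetric decompositions, semisimplicity of $\mathfrak a$ and regular elements. -/

section Decomposition

variable {K g : Type*} [Field K] [LieRing g] [LieAlgebra K g]
  {g₀ : LieSubalgebra K g} {g₁ a : Submodule K g}

namespace IsSymmetricDecomposition

theorem exists_add_eq (h : IsSymmetricDecomposition g₀ g₁) (x : g) :
    ∃ x₀ ∈ g₀, ∃ x₁ ∈ g₁, x₀ + x₁ = x :=
  Submodule.mem_sup.1 (h.isCompl.sup_eq_top ▸ Submodule.mem_top : x ∈ g₀.toSubmodule ⊔ g₁)

theorem eq_zero_of_mem (h : IsSymmetricDecomposition g₀ g₁) {x : g} (h₀ : x ∈ g₀)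
    (h₁ : x ∈ g₁) : x = 0 :=
  Submodule.disjoint_def.1 h.isCompl.disjoint x h₀ h₁

theorem eq_zero_of_add_eq_zero (h : IsSymmetricDecomposition g₀ g₁) {x y : g} (hx : x ∈ g₀)
    (hy : y ∈ g₁) (hxy : x + y = 0) : x = 0 ∧ y = 0 := by
  have hx' : x = 0 := h.eq_zero_of_mem hx (by
    rw [eq_neg_of_add_eq_zero_left hxy]; exact g₁.neg_mem hy)
  exact ⟨hx', by simpa [hx'] using hxy⟩

theorem lie_one_zero (h : IsSymmetricDecomposition g₀ g₁) {x y : g} (hx : x ∈ g₁)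
    (hy : y ∈ g₀) : ⁅x, y⁆ ∈ g₁ := by
  rw [← lie_skew]
  exact g₁.neg_mem (h.lie_zero_one y hy x hx)

/-- The linear map which is the identity on `g₀` and minus the identity on `g₁`. -/
noncomputable def reflection (h : IsSymmetricDecomposition g₀ g₁) : g →ₗ[K] g :=
  LinearMap.ofIsCompl h.isCompl g₀.toSubmodule.subtype (-g₁.subtype)

theorem reflection_zero (h : IsSymmetricDecomposition g₀ g₁) {x : g} (hx : x ∈ g₀) :
    h.reflection x = x :=
  LinearMap.ofIsCompl_apply_left (p := g₀.toSubmodule) h.isCompl ⟨x, hx⟩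

theorem reflection_one (h : IsSymmetricDecomposition g₀ g₁) {x : g} (hx : x ∈ g₁) :
    h.reflection x = -x :=
  LinearMap.ofIsCompl_apply_right (p := g₀.toSubmodule) h.isCompl ⟨x, hx⟩

theorem reflection_reflection (h : IsSymmetricDecomposition g₀ g₁) (x : g) :
    h.reflection (h.reflection x) = x := by
  obtain ⟨x₀, hx₀, x₁, hx₁, rfl⟩ := h.exists_add_eq x
  simp [h.reflection_zero hx₀, h.reflection_one hx₁]

theorem reflection_lie (h : IsSymmetricDecomposition g₀ g₁) (x y : g) :
    h.reflection ⁅x, y⁆ = ⁅h.reflection x, h.reflection y⁆ := by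
  obtain ⟨x₀, hx₀, x₁, hx₁, rfl⟩ := h.exists_add_eq x
  obtain ⟨y₀, hy₀, y₁, hy₁, rfl⟩ := h.exists_add_eq y
  simp only [map_add, add_lie, lie_add, h.reflection_zero hx₀, h.reflection_zero hy₀,
    h.reflection_one hx₁, h.reflection_one hy₁, h.reflection_zero (g₀.lie_mem hx₀ hy₀),
    h.reflection_one (h.lie_zero_one _ hx₀ _ hy₁), h.reflection_one (h.lie_one_zero hx₁ hy₀),
    h.reflection_zero (h.lie_one_one _ hx₁ _ hy₁), neg_lie, lie_neg]
  abel

/-- The involutive automorphism of a symmetric decomposition. -/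
noncomputable def involution (h : IsSymmetricDecomposition g₀ g₁) : g ≃ₗ⁅K⁆ g where
  __ := h.reflection
  map_lie' := h.reflection_lie _ _
  invFun := h.reflection
  left_inv := h.reflection_reflection
  right_inv := h.reflection_reflection

theorem involution_zero (h : IsSymmetricDecomposition g₀ g₁) {x : g} (hx : x ∈ g₀) :
    h.involution x = x := h.reflection_zero hx

theorem involution_one (h : IsSymmetricDecomposition g₀ g₁) {x : g} (hx : x ∈ g₁) :
    h.involution x = -x := h.reflection_one hx

/-- The involution preserves the Killing form and changes the sign of its value here. -/
theorem killingForm_eq_zero [CharZero K] (h : IsSymmetricDecomposition g₀ g₁) {x y : g}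
    (hx : x ∈ g₀) (hy : y ∈ g₁) : killingForm K g x y = 0 := by
  have := LieAlgebra.killingForm_of_equiv_apply h.involution x y
  rw [h.involution_zero hx, h.involution_one hy, map_neg] at this
  exact CharZero.neg_eq_self_iff.1 this

end IsSymmetricDecomposition

theorem killingForm_lie_right (x y z : g) :
    killingForm K g x ⁅y, z⁆ = killingForm K g ⁅x, y⁆ z :=
  (LieModule.traceForm_apply_lie_apply K g g x y z).symm

/-- Adjoining `x` to `a` gives an Abelian subspace of `g₁`, so maximality applies. -/
theorem IsMaximalAbelian.mem_of_lie_eq_zero (ha : IsMaximalAbelian g₁ a) {x : g} (hx : x ∈ g₁)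
    (hxa : ∀ y ∈ a, ⁅x, y⁆ = 0) : x ∈ a := by
  have hax : ∀ y ∈ a, ⁅y, x⁆ = 0 := fun y hy => by rw [← lie_skew, hxa y hy, neg_zero]
  refine ha.le_of_ge (y := a ⊔ Submodule.span K {x}) ⟨?_, ?_⟩ le_sup_left
    (le_sup_right (a := a) (Submodule.mem_span_singleton_self x))
  · exact sup_le ha.prop.1 ((Submodule.span_singleton_le_iff_mem _ _).2 hx)
  · intro u hu v hv
    obtain ⟨u₀, hu₀, u₁, hu₁, rfl⟩ := Submodule.mem_sup.1 hu
    obtain ⟨v₀, hv₀, v₁, hv₁, rfl⟩ := Submodule.mem_sup.1 hv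
    obtain ⟨c, rfl⟩ := Submodule.mem_span_singleton.1 hu₁
    obtain ⟨d, rfl⟩ := Submodule.mem_span_singleton.1 hv₁
    simp [ha.prop.2 u₀ hu₀ v₀ hv₀, hxa v₀ hv₀, hax u₀ hu₀]

theorem commute_ad_of_lie_eq_zero {x y : g} (hxy : ⁅x, y⁆ = 0) :
    Commute (LieAlgebra.ad K g x) (LieAlgebra.ad K g y) := by
  ext z
  simp only [Module.End.mul_apply, LieAlgebra.ad_apply]
  rw [leibniz_lie x y z, hxy, zero_lie, zero_add]

theorem killingForm_eq_zero_of_isNilpotent {x y : g} (hx : IsNilpotent (LieAlgebra.ad K g x))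
    (hxy : ⁅x, y⁆ = 0) : killingForm K g x y = 0 := by
  have hc := commute_ad_of_lie_eq_zero (K := K) hxy
  rw [killingForm_apply_apply]
  exact (LinearMap.isNilpotent_trace_of_isNilpotent (hc.isNilpotent_mul_right hx)).eq_zero

variable [FiniteDimensional K g] [CharZero K] [LieAlgebra.IsSemisimple K g]

/-- The abstract Jordan decomposition in a semisimple Lie algebra. -/
theorem exists_isNilpotent_isSemisimple_ad (x : g) :
    ∃ n s : g, x = n + s ∧ IsNilpotent (LieAlgebra.ad K g n) ∧
      (LieAlgebra.ad K g s).IsSemisimple ∧ ∀ y : g, ⁅x, y⁆ = 0 → ⁅s, y⁆ = 0 := by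
  obtain ⟨N, -, S, hSx, hN, hS, hNS⟩ := (LieAlgebra.ad K g x).exists_isNilpotent_isSemisimple
  have hc : Commute N S := by
    have : Commute (LieAlgebra.ad K g x) S := Algebra.commute_of_mem_adjoin_self hSx
    rw [hNS] at this
    simpa using this.sub_left (Commute.refl S)
  have hder := semisimple_part_derivation hN hS hc
    (LieModule.toEnd K g g : g →ₗ[K] g →ₗ[K] g) (fun v w => by
      rw [← hNS]
      exact leibniz_lie x v w)
  let D : LieDerivation K g g := ⟨S, fun y z => by
    rw [sub_eq_add_neg, lie_skew, add_comm]; exact hder y z⟩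
  obtain ⟨s, hs⟩ := LieDerivation.IsKilling.exists_eq_ad D
  have hsS : LieAlgebra.ad K g s = S := by
    ext y
    have hy := LieDerivation.congr_fun hs y
    rw [LieDerivation.ad_apply_apply] at hy
    exact hy
  refine ⟨x - s, s, by simp, ?_, hsS ▸ hS, fun y hy => ?_⟩
  · rw [map_sub, hsS, hNS]; simpa using hN
  · rw [← LieAlgebra.ad_apply K, hsS]
    exact apply_eq_zero_of_add_apply_eq_zero hN hS hc (by rw [← hNS]; exact hy)

/-- The elements of a maximal Abelian subspace on which the Killing form is nondegenerate
are semisimple. -/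
theorem IsMaximalAbelian.isSemisimple_ad (h : IsSymmetricDecomposition g₀ g₁)
    (ha : IsMaximalAbelian g₁ a) (hnd : ((killingForm K g).restrict a).Nondegenerate)
    {x : g} (hx : x ∈ a) : (LieAlgebra.ad K g x).IsSemisimple := by
  obtain ⟨n, s, hxs, hn, hs, hsc⟩ := exists_isNilpotent_isSemisimple_ad (K := K) x
  obtain ⟨s₀, hs₀, s₁, hs₁, rfl⟩ := h.exists_add_eq s
  have hsa : ∀ y ∈ a, ⁅s₀ + s₁, y⁆ = 0 := fun y hy => hsc y (ha.prop.2 x hx y hy)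
  have hs01 : ∀ y ∈ a, ⁅s₁, y⁆ = 0 ∧ ⁅s₀, y⁆ = 0 := fun y hy =>
    h.eq_zero_of_add_eq_zero (h.lie_one_one _ hs₁ _ (ha.prop.1 hy))
      (h.lie_zero_one _ hs₀ _ (ha.prop.1 hy)) (by rw [add_comm, ← add_lie]; exact hsa y hy)
  have hs₁a : s₁ ∈ a := ha.mem_of_lie_eq_zero hs₁ fun y hy => (hs01 y hy).1
  have hnx : n = (x - s₁) - s₀ := by rw [hxs]; abel
  -- The nilpotent part `n` is orthogonal to `a`, and so is `s₀`; hence `x - s₁`, which lies in `a`,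
  -- is in the radical of the restricted form.
  have hx₁ : x = s₁ := by
    have hz : (⟨x - s₁, sub_mem hx hs₁a⟩ : a) = 0 := by
      refine hnd.1 _ fun y => ?_
      have hny : killingForm K g n y = 0 := by
        refine killingForm_eq_zero_of_isNilpotent hn ?_
        rw [hnx, sub_lie, sub_lie, ha.prop.2 x hx y y.2, (hs01 y y.2).1, (hs01 y y.2).2]
        simp
      rw [hnx, map_sub, LinearMap.sub_apply,
        h.killingForm_eq_zero hs₀ (ha.prop.1 y.2), sub_zero] at hny
      exact hny
    exact sub_eq_zero.1 (congrArg Subtype.val hz)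
  -- Now `n = -s₀`. Adding the involution's image of `s` isolates `2 s₀ = -2 n`, whose adjoint map
  -- is both semisimple and nilpotent, hence zero.
  have hconj : (LieAlgebra.ad K g (h.involution (s₀ + s₁))).IsSemisimple := by
    refine (h.involution.toLinearEquiv.isSemisimple_iff (LieAlgebra.ad K g (s₀ + s₁)) _ ?_).1 hs
    ext y
    exact h.involution.map_lie _ y
  have hc : Commute (LieAlgebra.ad K g (s₀ + s₁))
      (LieAlgebra.ad K g (h.involution (s₀ + s₁))) := by
    refine commute_ad_of_lie_eq_zero ?_
    rw [map_add, h.involution_zero hs₀,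
      h.involution_one hs₁]
    have h10 : ⁅s₀, s₁⁆ = 0 := (hs01 s₁ hs₁a).2
    have h10' : ⁅s₁, s₀⁆ = 0 := by rw [← lie_skew, h10, neg_zero]
    simp [h10, h10']
  have hs₀ss : (LieAlgebra.ad K g (s₀ + s₁) +
      LieAlgebra.ad K g (h.involution (s₀ + s₁))).IsSemisimple := hs.add_of_commute hc hconj
  have heq : LieAlgebra.ad K g (s₀ + s₁) + LieAlgebra.ad K g (h.involution (s₀ + s₁)) =
      -(2 : K) • LieAlgebra.ad K g n := by
    have hinv : h.involution (s₀ + s₁) = s₀ - s₁ := by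
      rw [map_add, h.involution_zero hs₀, h.involution_one hs₁, sub_eq_add_neg]
    rw [hnx, ← hx₁, sub_self, zero_sub, hx₁, hinv, map_neg, smul_neg, neg_smul, neg_neg,
      two_smul, ← map_add, ← map_add]
    congr 1
    abel
  have hn0 : LieAlgebra.ad K g n = 0 := by
    rw [heq] at hs₀ss
    exact Module.End.eq_zero_of_isNilpotent_isSemisimple hn
      ((Module.End.IsSemisimple_smul_iff (by simp)).1 hs₀ss)
  rw [hxs, map_add, hn0, zero_add]
  exact hs

/-- Existence of a regular element. -/
theorem IsMaximalAbelian.exists_regular (h : IsSymmetricDecomposition g₀ g₁)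
    (ha : IsMaximalAbelian g₁ a) (hnd : ((killingForm K g).restrict a).Nondegenerate) :
    ∃ x ∈ a, ∀ z : g, ⁅x, z⁆ = 0 → ∀ y ∈ a, ⁅y, z⁆ = 0 := by
  have : Infinite K := CharZero.infinite K
  obtain ⟨x, hx⟩ := exists_forall_ker_le ((LieAlgebra.ad K g : g →ₗ[K] End K g) ∘ₗ a.subtype)
    (fun x y => commute_ad_of_lie_eq_zero (ha.prop.2 x x.2 y y.2))
    (fun x => ha.isSemisimple_ad h hnd x.2)
  exact ⟨x, x.2, fun z hz y hy => hx ⟨y, hy⟩ hz⟩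

end Decomposition

/-! ### Characters and prolongation of a tableau determined by evaluation at one vector. -/

section Tableau

variable {K V W : Type*} [Field K] [AddCommGroup V] [Module K V] [AddCommGroup W] [Module K W]

theorem mem_prolongation [CharZero K] {A : Submodule K (V →ₗ[K] W)} {F : V →ₗ[K] A} :
    F ∈ prolongation A ↔ ∀ v w, (F v : V →ₗ[K] W) w = (F w : V →ₗ[K] W) v := by
  have h2 : (2 : K)⁻¹ ≠ 0 := by simp
  rw [prolongation, LinearMap.mem_ker]
  constructor
  · intro h v w
    have := LinearMap.congr_fun₂ h v w
    exact sub_eq_zero.1 ((smul_eq_zero.1 this).resolve_left h2)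
  · intro h
    ext v w
    change (2 : K)⁻¹ • ((F v : V →ₗ[K] W) w - (F w : V →ₗ[K] W) v) = 0
    rw [h v w, sub_self, smul_zero]

/-- If the elements of `A` are determined by their values at one vector, then the first character
of `A` is its dimension and the other characters vanish. -/
theorem hasCharacters_of_injective_eval [FiniteDimensional K V] (A : Submodule K (V →ₗ[K] W))
    (x : V) (hx : ∀ Q ∈ A, Q x = 0 → Q = 0) :
    HasCharacters A (fun j => if j.val = 0 then finrank K A else 0) := by
  obtain ⟨l, hl⟩ := exists_completeFlag_mem (K := K) x
  have hann : ∀ j, j ≠ 0 → annihilated A l j = ⊥ := fun j hj =>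
    (Submodule.eq_bot_iff _).2 fun Q hQ => hx Q hQ.1 (hQ.2 x (hl j hj))
  have hzero : ∀ l' : CompleteFlag K V, annihilated A l' 0 = A := by
    intro l'
    have hb : l'.space 0 = ⊥ := Submodule.finrank_eq_zero.1 (l'.finrank_space 0)
    ext Q
    refine ⟨fun h => h.1, fun h => ⟨h, fun v hv => ?_⟩⟩
    rw [hb, Submodule.mem_bot] at hv
    rw [hv, map_zero]
  refine ⟨l, fun j l' => ?_, fun j => ?_⟩
  · by_cases hj : j = 0
    · rw [hj, hzero, hzero]
    · rw [hann j hj, finrank_bot]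
      exact Nat.zero_le _
  · by_cases hj : j = 0
    · subst hj
      rw [hzero]
      simp
    · have hj' : 0 < j.val := Nat.pos_of_ne_zero fun h => hj (Fin.ext h)
      have hV : 0 < finrank K V := by have := j.is_le; omega
      rw [hann j hj, finrank_bot, add_zero, Finset.sum_eq_single (⟨0, hV⟩ : Fin (finrank K V))]
      · simp
      · intro i _ hi
        exact if_neg fun h => hi (Fin.ext h)
      · intro h
        exact absurd (by simpa using hj') h

/-- If `F x = Q`, symmetry forces `F v` to be the unique element of `A` with value `Q v` at `x`. The
hypothesis `hsymm` says that the `F` so defined from any `Q` is symmetric; there `P` and `R` play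
the roles of `F v` and `F w`. -/
theorem finrank_prolongation_of_bijective_eval [CharZero K] (A : Submodule K (V →ₗ[K] W))
    (x : V) (hinj : ∀ Q ∈ A, Q x = 0 → Q = 0) (hsurj : ∀ w, ∃ Q ∈ A, Q x = w)
    (hsymm : ∀ Q ∈ A, ∀ P ∈ A, ∀ R ∈ A, ∀ v w, P x = Q v → R x = Q w → P w = R v) :
    finrank K (prolongation A) = finrank K A := by
  let ev : A →ₗ[K] W := (LinearMap.applyₗ x) ∘ₗ A.subtype
  have hev : Function.Bijective ev := by
    refine ⟨(injective_iff_map_eq_zero _).2 fun Q hQ => Subtype.ext (hinj Q Q.2 hQ), fun w => ?_⟩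
    obtain ⟨Q, hQ, rfl⟩ := hsurj w
    exact ⟨⟨Q, hQ⟩, rfl⟩
  let e : A ≃ₗ[K] W := LinearEquiv.ofBijective ev hev
  have he : ∀ w, ((e.symm w : A) : V →ₗ[K] W) x = w := fun w => e.apply_symm_apply w
  let E : prolongation A →ₗ[K] A := (LinearMap.applyₗ x) ∘ₗ (prolongation A).subtype
  refine (LinearEquiv.ofBijective E ⟨fun F G hFG => ?_, fun Q => ?_⟩).finrank_eq
  · refine Subtype.ext (LinearMap.ext fun v => hev.1 ?_)
    have hFG' : F.1 x = G.1 x := hFG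
    change (F.1 v : V →ₗ[K] W) x = (G.1 v : V →ₗ[K] W) x
    rw [mem_prolongation.1 F.2 v x, mem_prolongation.1 G.2 v x, hFG']
  · refine ⟨⟨e.symm.toLinearMap ∘ₗ (Q : V →ₗ[K] W), mem_prolongation.2 fun v w => ?_⟩, ?_⟩
    · exact hsymm Q Q.2 _ (e.symm (Q.1 v)).2 _ (e.symm (Q.1 w)).2 v w (he _) (he _)
    · exact e.symm_apply_apply Q

theorem isInvolutive_of_bijective_eval [CharZero K] [FiniteDimensional K V]
    (A : Submodule K (V →ₗ[K] W))
    (x : V) (hinj : ∀ Q ∈ A, Q x = 0 → Q = 0) (hsurj : ∀ w, ∃ Q ∈ A, Q x = w)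
    (hsymm : ∀ Q ∈ A, ∀ P ∈ A, ∀ R ∈ A, ∀ v w, P x = Q v → R x = Q w → P w = R v) :
    IsInvolutive A := by
  refine ⟨_, hasCharacters_of_injective_eval A x hinj, ?_⟩
  rw [finrank_prolongation_of_bijective_eval A x hinj hsurj hsymm]
  rcases Nat.eq_zero_or_pos (finrank K V) with hV | hV
  -- With $k=0$ there is no $s'_1$ to carry the dimension, but then `x = 0` and `hinj` gives `A =
  -- ⊥`.
  · have : Subsingleton V := finrank_zero_iff.1 hV
    have hA : A = ⊥ := (Submodule.eq_bot_iff _).2 fun Q hQ =>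
      hinj Q hQ (by rw [Subsingleton.elim x 0, map_zero])
    subst hA
    simp
  · rw [Finset.sum_eq_single (⟨0, hV⟩ : Fin (finrank K V))]
    · simp
    · intro i _ hi
      rw [if_neg fun h => hi (Fin.ext h), mul_zero]
    · intro h
      exact absurd (Finset.mem_univ _) h

end Tableau

/-! ### Bracket identities for the Cartan tableau. -/

section Cartan

variable {K g : Type*} [Field K] [LieRing g] [LieAlgebra K g]
  {g₀ : LieSubalgebra K g} {g₁ a : Submodule K g}

theorem components_of_mem_right {a b : Submodule K g} (hab : Disjoint a b) {z : g} (hz : z ∈ b)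
    (hz' : z ∈ a ⊔ b) : components hab ⟨z, hz'⟩ = (0, ⟨z, hz⟩) := by
  rw [components, LinearEquiv.symm_apply_eq]
  apply Subtype.ext
  simp

theorem tau_apply_of_mem {a b : Submodule K g} (hab : Disjoint a b) (Q : a →ₗ[K] b)
    (hR : R Q = 0) {x y : a} (hxy : graphBracket Q x y ∈ b) :
    tau hab Q hR x y = ⟨graphBracket Q x y, hxy⟩ := by
  simp only [tau, LinearMap.mk₂_apply, LinearMap.comp_apply, LinearEquiv.coe_coe,
    components_of_mem_right hab hxy]
  simp

theorem disjoint_bSpace (h : IsSymmetricDecomposition g₀ g₁) (ha : a ≤ g₁) :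
    Disjoint a (bSpace g₀ a) :=
  (h.isCompl.disjoint.mono inf_le_left ha).symm

theorem cartanMap_apply (h : IsSymmetricDecomposition g₀ g₁) (ha : a ≤ g₁)
    (X : mSpace g₁ a) (y : a) : (cartanMap h ha X y : g) = -⁅(X : g), (y : g)⁆ := rfl

theorem killingForm_mSpace {X y : g} (hX : X ∈ mSpace g₁ a) (hy : y ∈ a) :
    killingForm K g y X = 0 := hX.1 y hy

theorem lie_mem_bSpace (h : IsSymmetricDecomposition g₀ g₁) (ha : a ≤ g₁) {X y : g}
    (hX : X ∈ mSpace g₁ a) (hy : y ∈ a) : ⁅y, X⁆ ∈ bSpace g₀ a := by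
  rw [← lie_skew]; exact neg_lie_mem_bSpace h ha hX hy

theorem eq_zero_of_mem_mSpace (hnd : ((killingForm K g).restrict a).Nondegenerate) {X : g}
    (hX : X ∈ mSpace g₁ a) (hXa : X ∈ a) : X = 0 := by
  have : (⟨X, hXa⟩ : a) = 0 := hnd.2 _ fun y => killingForm_mSpace hX y.2
  exact congrArg Subtype.val this

/-- The bracket `[y + Q(y), z + Q(z)]` for `Q = -ad_X`. -/
theorem graphBracket_cartanMap (h : IsSymmetricDecomposition g₀ g₁) (ha : IsMaximalAbelian g₁ a)
    (X : mSpace g₁ a) (y z : a) :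
    graphBracket (cartanMap h ha.prop.1 X) y z = ⁅⁅(X : g), (y : g)⁆, ⁅(X : g), (z : g)⁆⁆ := by
  change ⁅(y : g) + -⁅(X : g), (y : g)⁆, (z : g) + -⁅(X : g), (z : g)⁆⁆ = _
  have hyz := ha.prop.2 y y.2 z z.2
  have hj := leibniz_lie (X : g) (y : g) (z : g)
  rw [hyz, lie_zero] at hj
  simp only [add_lie, lie_add, neg_lie, lie_neg, hyz, zero_add]
  -- The terms linear in `X` add up to $-[X,[y,z]]=0$.
  rw [neg_add, neg_neg, ← add_assoc, ← neg_add, ← hj, neg_zero, zero_add]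

theorem lie_lie_comm (ha : IsMaximalAbelian g₁ a) {y z : g} (hy : y ∈ a) (hz : z ∈ a) (X : g) :
    ⁅y, ⁅z, X⁆⁆ = ⁅z, ⁅y, X⁆⁆ := by
  rw [leibniz_lie y z X, ha.prop.2 y hy z hz, zero_lie, zero_add]

/-- For $Z\in(\mathfrak g_0)_{\mathfrak a}$, invariance turns the pairing with $Z$ into
$-\langle[Z,X],[y,[z,X]]\rangle$. This is symmetric in $y,z$ while the bracket is skew, so the
pairing vanishes. -/
theorem lie_lie_mem_bSpace [CharZero K] (h : IsSymmetricDecomposition g₀ g₁)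
    (ha : IsMaximalAbelian g₁ a) {X y z : g} (hX : X ∈ g₁) (hy : y ∈ a) (hz : z ∈ a) :
    ⁅⁅X, y⁆, ⁅X, z⁆⁆ ∈ bSpace g₀ a := by
  have hy₁ := ha.prop.1 hy
  have hz₁ := ha.prop.1 hz
  refine ⟨g₀.lie_mem (h.lie_one_one _ hX _ hy₁) (h.lie_one_one _ hX _ hz₁), fun Z hZ => ?_⟩
  have key : ∀ y ∈ a, ∀ z ∈ a, killingForm K g Z ⁅⁅X, y⁆, ⁅X, z⁆⁆ =
      -killingForm K g ⁅Z, X⁆ ⁅y, ⁅z, X⁆⁆ := by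
    intro y hy z hz
    rw [killingForm_lie_right, leibniz_lie Z X y, hZ.2 y hy, lie_zero, add_zero,
      ← killingForm_lie_right, ← lie_skew X z, lie_neg, map_neg]
  have hskew : killingForm K g Z ⁅⁅X, y⁆, ⁅X, z⁆⁆ = -killingForm K g Z ⁅⁅X, y⁆, ⁅X, z⁆⁆ := by
    conv_lhs => rw [key y hy z hz, lie_lie_comm ha hy hz, ← key z hz y hy]
    rw [← lie_skew, map_neg]
  exact self_eq_neg.1 hskew

/-- Apply $\mathrm{ad}_X$ to $[y,[X,z]]=[z,[X,y]]$ and expand both sides. The result exhibits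
$\tau_Q$ as a skew-symmetrization. -/
theorem two_smul_lie_lie (ha : IsMaximalAbelian g₁ a) {y z : g} (hy : y ∈ a) (hz : z ∈ a)
    (X : g) :
    (2 : K) • ⁅⁅X, y⁆, ⁅X, z⁆⁆ = -⁅⁅X, ⁅X, y⁆⁆, z⁆ + ⁅⁅X, ⁅X, z⁆⁆, y⁆ := by
  have h1 := leibniz_lie X y ⁅X, z⁆
  have h2 := leibniz_lie X z ⁅X, y⁆
  have h3 : ⁅y, ⁅X, z⁆⁆ = ⁅z, ⁅X, y⁆⁆ := by
    rw [← lie_skew X z, ← lie_skew X y, lie_neg, lie_neg, lie_lie_comm ha hy hz]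
  rw [h3] at h1
  have h4 : ⁅⁅X, y⁆, ⁅X, z⁆⁆ = ⁅⁅X, z⁆, ⁅X, y⁆⁆ + ⁅z, ⁅X, ⁅X, y⁆⁆⁆ - ⁅y, ⁅X, ⁅X, z⁆⁆⁆ :=
    eq_sub_of_add_eq (h1.symm.trans h2)
  rw [two_smul]
  nth_rw 1 [h4]
  rw [← lie_skew ⁅X, ⁅X, y⁆⁆ z, ← lie_skew ⁅X, ⁅X, z⁆⁆ y, ← lie_skew ⁅X, z⁆ ⁅X, y⁆]
  abel

theorem eq_zero_of_lie_eq_zero_of_mem_mSpace (ha : IsMaximalAbelian g₁ a)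
    (hnd : ((killingForm K g).restrict a).Nondegenerate) {x : g}
    (hreg : ∀ z : g, ⁅x, z⁆ = 0 → ∀ y ∈ a, ⁅y, z⁆ = 0) {X : g} (hX : X ∈ mSpace g₁ a)
    (hxX : ⁅x, X⁆ = 0) : X = 0 :=
  eq_zero_of_mem_mSpace hnd hX (ha.mem_of_lie_eq_zero hX.2 fun y hy => by
    rw [← lie_skew, hreg X hxX y hy, neg_zero])

theorem cartanMap_injective (h : IsSymmetricDecomposition g₀ g₁) (ha : IsMaximalAbelian g₁ a)
    (hnd : ((killingForm K g).restrict a).Nondegenerate) :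
    Function.Injective (cartanMap h ha.prop.1) := by
  refine (injective_iff_map_eq_zero _).2 fun X hX => Subtype.ext ?_
  refine eq_zero_of_mem_mSpace hnd X.2 (ha.mem_of_lie_eq_zero X.2.2 fun y hy => ?_)
  exact neg_eq_zero.1 (congrArg Subtype.val (LinearMap.congr_fun hX ⟨y, hy⟩))

theorem R_cartanMap [CharZero K] (h : IsSymmetricDecomposition g₀ g₁) (ha : IsMaximalAbelian g₁ a)
    (X : mSpace g₁ a) : R (cartanMap h ha.prop.1 X) = 0 := by
  ext y z
  refine (Submodule.Quotient.mk_eq_zero _).2 ?_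
  rw [graphBracket_cartanMap h ha]
  exact le_sup_right (a := a) (lie_lie_mem_bSpace h ha X.2.2 y.2 z.2)

theorem cartanTableau_eval_injective (h : IsSymmetricDecomposition g₀ g₁)
    (ha : IsMaximalAbelian g₁ a) (hnd : ((killingForm K g).restrict a).Nondegenerate) (x : a)
    (hreg : ∀ z : g, ⁅(x : g), z⁆ = 0 → ∀ y ∈ a, ⁅y, z⁆ = 0) :
    ∀ Q ∈ cartanTableau h ha.prop.1, Q x = 0 → Q = 0 := by
  rintro _ ⟨X, rfl⟩ hQ
  have hX : -⁅(X : g), (x : g)⁆ = 0 := congrArg Subtype.val hQ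
  rw [lie_skew] at hX
  have : X = 0 := Subtype.ext (eq_zero_of_lie_eq_zero_of_mem_mSpace ha hnd hreg X.2 hX)
  rw [this, map_zero]

end Cartan

/-! ### Torsion, bijectivity of evaluation at a regular element, and involutivity. -/

section CartanTableau

variable {K g : Type*} [Field K] [LieRing g] [LieAlgebra K g]
  [FiniteDimensional K g]
  {g₀ : LieSubalgebra K g} {g₁ a : Submodule K g}

theorem isCompl_orthogonal (hnd : ((killingForm K g).restrict a).Nondegenerate) :
    IsCompl a ((killingForm K g).orthogonal a) :=
  LinearMap.BilinForm.isCompl_orthogonal_of_restrict_nondegenerate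
    (LieModule.traceForm_isSymm K g g).isRefl hnd

/-- The projection onto `a^⊥` along `a`. -/
noncomputable def orthogonalProj (hnd : ((killingForm K g).restrict a).Nondegenerate) : g →ₗ[K] g :=
  LinearMap.ofIsCompl (isCompl_orthogonal hnd) 0 ((killingForm K g).orthogonal a).subtype

theorem orthogonalProj_spec (hnd : ((killingForm K g).restrict a).Nondegenerate) (x : g) :
    orthogonalProj hnd x ∈ (killingForm K g).orthogonal a ∧ x - orthogonalProj hnd x ∈ a := by
  have hI := isCompl_orthogonal hnd
  obtain ⟨u, hu, v, hv, rfl⟩ := Submodule.mem_sup.1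
    (hI.sup_eq_top ▸ Submodule.mem_top : x ∈ a ⊔ (killingForm K g).orthogonal a)
  have hu' : orthogonalProj hnd u = 0 := LinearMap.ofIsCompl_apply_left hI ⟨u, hu⟩
  have hv' : orthogonalProj hnd v = v := LinearMap.ofIsCompl_apply_right hI ⟨v, hv⟩
  rw [map_add, hu', hv', zero_add, add_sub_cancel_right]
  exact ⟨hv, hu⟩

theorem orthogonalProj_mem_mSpace (hnd : ((killingForm K g).restrict a).Nondegenerate)
    (ha : a ≤ g₁) {x : g} (hx : x ∈ g₁) : orthogonalProj hnd x ∈ mSpace g₁ a := by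
  obtain ⟨h1, h2⟩ := orthogonalProj_spec hnd x
  exact ⟨h1, by simpa using sub_mem hx (ha h2)⟩

theorem lie_orthogonalProj (ha : IsMaximalAbelian g₁ a)
    (hnd : ((killingForm K g).restrict a).Nondegenerate) (x : g) {y : g} (hy : y ∈ a) :
    ⁅orthogonalProj hnd x, y⁆ = ⁅x, y⁆ := by
  have := ha.prop.2 _ (orthogonalProj_spec hnd x).2 y hy
  rw [sub_lie, sub_eq_zero] at this
  exact this.symm

theorem tau_cartanMap_mem_range [CharZero K] (h : IsSymmetricDecomposition g₀ g₁)
    (ha : IsMaximalAbelian g₁ a) (hnd : ((killingForm K g).restrict a).Nondegenerate)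
    (X : mSpace g₁ a) (hab : Disjoint a (bSpace g₀ a)) (hR : R (cartanMap h ha.prop.1 X) = 0) :
    tau hab (cartanMap h ha.prop.1 X) hR ∈ LinearMap.range (rho (cartanTableau h ha.prop.1)) := by
  -- $[X,[X,y]]$ lies in $\mathfrak g_1$ but perhaps not in $\mathfrak m$. Projecting off its
  -- $\mathfrak a$-component is harmless, since $\mathfrak a$ commutes with itself.
  let Y : a →ₗ[K] mSpace g₁ a := LinearMap.codRestrict (mSpace g₁ a)
    (orthogonalProj hnd ∘ₗ LieAlgebra.ad K g X ∘ₗ LieAlgebra.ad K g X ∘ₗ a.subtype) fun y =>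
      orthogonalProj_mem_mSpace hnd ha.prop.1
        (h.lie_one_zero X.2.2 (h.lie_one_one _ X.2.2 _ (ha.prop.1 y.2)))
  refine ⟨(cartanMap h ha.prop.1).rangeRestrict ∘ₗ Y, ?_⟩
  ext y z
  have hb : graphBracket (cartanMap h ha.prop.1 X) y z ∈ bSpace g₀ a := by
    rw [graphBracket_cartanMap h ha]
    exact lie_lie_mem_bSpace h ha X.2.2 y.2 z.2
  rw [tau_apply_of_mem hab _ hR hb]
  change (2 : K)⁻¹ • (-⁅orthogonalProj hnd ⁅(X : g), ⁅(X : g), (y : g)⁆⁆, (z : g)⁆ -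
    -⁅orthogonalProj hnd ⁅(X : g), ⁅(X : g), (z : g)⁆⁆, (y : g)⁆) = graphBracket _ y z
  rw [graphBracket_cartanMap h ha, lie_orthogonalProj ha hnd _ z.2, lie_orthogonalProj ha hnd _ y.2,
    sub_neg_eq_add, ← two_smul_lie_lie (K := K) ha y.2 z.2, smul_smul]
  simp

variable [CharZero K] [LieAlgebra.IsSemisimple K g]

theorem eq_zero_of_killingForm_zero (h : IsSymmetricDecomposition g₀ g₁) {z : g} (hz : z ∈ g₀)
    (hzz : ∀ w ∈ g₀, killingForm K g z w = 0) : z = 0 := by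
  refine (LieAlgebra.IsKilling.killingForm_nondegenerate K g).1 z fun w => ?_
  obtain ⟨w₀, hw₀, w₁, hw₁, rfl⟩ := h.exists_add_eq w
  rw [map_add, hzz w₀ hw₀, h.killingForm_eq_zero hz hw₁, add_zero]

/-- This is the $\mathfrak g_0$-part of $\mathfrak
g=\ker\mathrm{ad}_x\oplus\mathrm{im}\,\mathrm{ad}_x$: $\mathrm{ad}_x$ interchanges $\mathfrak g_0$
and $\mathfrak g_1$, so the kernel is graded. -/
theorem exists_lie_add_eq (h : IsSymmetricDecomposition g₀ g₁) (ha : IsMaximalAbelian g₁ a)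
    (hnd : ((killingForm K g).restrict a).Nondegenerate) {x : g} (hx : x ∈ a)
    (hreg : ∀ z : g, ⁅x, z⁆ = 0 → ∀ y ∈ a, ⁅y, z⁆ = 0) {w : g} (hw : w ∈ g₀) :
    ∃ u ∈ g₁, ∃ v ∈ centralizerIn g₀ a, ⁅x, u⁆ + v = w := by
  have hss := ha.isSemisimple_ad h hnd hx
  have hI := isCompl_ker_range hss
  obtain ⟨v, hv, _, ⟨u, rfl⟩, hvu⟩ := Submodule.mem_sup.1
    (hI.sup_eq_top ▸ Submodule.mem_top : w ∈ LinearMap.ker (LieAlgebra.ad K g x) ⊔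
      LinearMap.range (LieAlgebra.ad K g x))
  have hv' : ⁅x, v⁆ = 0 := hv
  rw [LieAlgebra.ad_apply] at hvu
  obtain ⟨v₀, hv₀, v₁, hv₁, rfl⟩ := h.exists_add_eq v
  obtain ⟨u₀, hu₀, u₁, hu₁, rfl⟩ := h.exists_add_eq u
  have hx₁ := ha.prop.1 hx
  have h0 := h.eq_zero_of_add_eq_zero (x := v₀ + ⁅x, u₁⁆ - w) (y := v₁ + ⁅x, u₀⁆)
    (g₀.sub_mem (g₀.add_mem hv₀ (h.lie_one_one _ hx₁ _ hu₁)) hw)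
    (g₁.add_mem hv₁ (h.lie_one_zero hx₁ hu₀)) (by rw [← hvu, lie_add]; abel)
  have hv0 := h.eq_zero_of_add_eq_zero (h.lie_one_one _ hx₁ _ hv₁) (h.lie_one_zero hx₁ hv₀)
    (by rw [add_comm, ← lie_add, hv'])
  refine ⟨u₁, hu₁, v₀, ⟨hv₀, fun y hy => ?_⟩, ?_⟩
  · rw [← lie_skew, hreg v₀ hv0.2 y hy, neg_zero]
  · rw [add_comm]; exact sub_eq_zero.1 h0.1

/-- Such a `z` is orthogonal to $[x,\mathfrak g_1]$ by invariance and to $(\mathfrak g_0)_{\mathfrak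
a}$ by definition of $\mathfrak b$, hence to all of $\mathfrak g_0$, where the Killing form is
nondegenerate. -/
theorem eq_zero_of_lie_eq_zero_of_mem_bSpace (h : IsSymmetricDecomposition g₀ g₁)
    (ha : IsMaximalAbelian g₁ a)
    (hnd : ((killingForm K g).restrict a).Nondegenerate) {x : g} (hx : x ∈ a)
    (hreg : ∀ z : g, ⁅x, z⁆ = 0 → ∀ y ∈ a, ⁅y, z⁆ = 0) {z : g} (hz : z ∈ bSpace g₀ a)
    (hxz : ⁅x, z⁆ = 0) : z = 0 := by
  refine eq_zero_of_killingForm_zero h hz.1 fun w hw => ?_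
  obtain ⟨u, hu, v, hv, rfl⟩ := exists_lie_add_eq h ha hnd hx hreg hw
  have hvz : killingForm K g v z = 0 := hz.2 v hv
  rw [map_add, killingForm_lie_right, ← lie_skew, hxz, LieModule.traceForm_comm K g g z v, hvz]
  simp

theorem exists_lie_eq_of_mem_bSpace (h : IsSymmetricDecomposition g₀ g₁)
    (ha : IsMaximalAbelian g₁ a)
    (hnd : ((killingForm K g).restrict a).Nondegenerate) {x : g} (hx : x ∈ a)
    (hreg : ∀ z : g, ⁅x, z⁆ = 0 → ∀ y ∈ a, ⁅y, z⁆ = 0) {z : g} (hz : z ∈ bSpace g₀ a) :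
    ∃ X ∈ mSpace g₁ a, -⁅X, x⁆ = z := by
  obtain ⟨u, hu, v, hv, rfl⟩ := exists_lie_add_eq h ha hnd hx hreg hz.1
  have hm := orthogonalProj_mem_mSpace hnd ha.prop.1 hu
  have hux : -⁅orthogonalProj hnd u, x⁆ = ⁅x, u⁆ := by
    rw [lie_orthogonalProj ha hnd u hx, lie_skew]
  have hb : ⁅x, u⁆ ∈ bSpace g₀ a := hux ▸ neg_lie_mem_bSpace h ha.prop.1 hm hx
  have hv0 : v = 0 := eq_zero_of_lie_eq_zero_of_mem_bSpace h ha hnd hx hreg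
    (by simpa using sub_mem hz hb) (by rw [← lie_skew, hv.2 x hx, neg_zero])
  exact ⟨_, hm, by rw [hux, hv0, add_zero]⟩

theorem isInvolutive_cartanTableau (h : IsSymmetricDecomposition g₀ g₁)
    (ha : IsMaximalAbelian g₁ a) (hnd : ((killingForm K g).restrict a).Nondegenerate) :
    IsInvolutive (cartanTableau h ha.prop.1) := by
  obtain ⟨x, hx, hreg⟩ := ha.exists_regular h hnd
  refine isInvolutive_of_bijective_eval _ (⟨x, hx⟩ : a)
    (cartanTableau_eval_injective h ha hnd ⟨x, hx⟩ hreg) ?_ ?_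
  · rintro ⟨z, hz⟩
    obtain ⟨X, hX, rfl⟩ := exists_lie_eq_of_mem_bSpace h ha hnd hx hreg hz
    exact ⟨_, ⟨⟨X, hX⟩, rfl⟩, rfl⟩
  · rintro _ ⟨X, rfl⟩ _ ⟨P, rfl⟩ _ ⟨Q, rfl⟩ v w hP hQ
    have hP' : ⁅x, (P : g)⁆ = ⁅(v : g), (X : g)⁆ := by
      have : -⁅(P : g), x⁆ = -⁅(X : g), (v : g)⁆ := congrArg Subtype.val hP
      rwa [lie_skew, lie_skew] at this
    have hQ' : ⁅x, (Q : g)⁆ = ⁅(w : g), (X : g)⁆ := by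
      have : -⁅(Q : g), x⁆ = -⁅(X : g), (w : g)⁆ := congrArg Subtype.val hQ
      rwa [lie_skew, lie_skew] at this
    apply Subtype.ext
    rw [cartanMap_apply, cartanMap_apply, lie_skew, lie_skew, ← sub_eq_zero]
    -- As $\mathrm{ad}_x$ is injective on $\mathfrak b$, it suffices to compare after applying it:
    -- $[x,[w,P]]=[w,[v,X]]=[v,[w,X]]=[x,[v,Q]]$.
    refine eq_zero_of_lie_eq_zero_of_mem_bSpace h ha hnd hx hreg
      (sub_mem (lie_mem_bSpace h ha.prop.1 P.2 w.2) (lie_mem_bSpace h ha.prop.1 Q.2 v.2)) ?_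
    rw [lie_sub, lie_lie_comm ha hx w.2, lie_lie_comm ha hx v.2, hP', hQ',
      lie_lie_comm ha v.2 w.2, sub_self]

end CartanTableau

end LieTableau

theorem proposition2p1 {K g : Type*} [Field K] [CharZero K] [LieRing g] [LieAlgebra K g]
    [FiniteDimensional K g] [LieAlgebra.IsSemisimple K g]
    (g₀ : LieSubalgebra K g) (g₁ a : Submodule K g)
    (h : LieTableau.IsSymmetricDecomposition g₀ g₁)
    (ha : LieTableau.IsMaximalAbelian g₁ a)
    (hnd : ((killingForm K g).restrict a).Nondegenerate) :
    Function.Injective (LieTableau.cartanMap h ha.prop.1) ∧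
    LieTableau.IsTableauOver a (LieTableau.bSpace g₀ a)
      (LieTableau.cartanTableau h ha.prop.1) ∧
    LieTableau.HasCharacters (LieTableau.cartanTableau h ha.prop.1)
      (fun j => if j.val = 0 then Module.finrank K (LieTableau.mSpace g₁ a) else 0) := by
  have hinj := LieTableau.cartanMap_injective h ha hnd
  refine ⟨hinj, ⟨LieTableau.disjoint_bSpace h ha.prop.1, ?_, ?_,
    LieTableau.isInvolutive_cartanTableau h ha hnd⟩, ?_⟩
  · rintro _ ⟨X, rfl⟩
    exact LieTableau.R_cartanMap h ha X
  · rintro _ ⟨X, rfl⟩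
    exact LieTableau.tau_cartanMap_mem_range h ha hnd X _ _
  · obtain ⟨x, hx, hreg⟩ := ha.exists_regular h hnd
    have hfin : Module.finrank K (LieTableau.cartanTableau h ha.prop.1) =
        Module.finrank K (LieTableau.mSpace g₁ a) := LinearMap.finrank_range_of_inj hinj
    rw [← hfin]
    exact LieTableau.hasCharacters_of_injective_eval _ ⟨x, hx⟩
      (LieTableau.cartanTableau_eval_injective h ha hnd ⟨x, hx⟩ hreg)
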